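/- Let $b_1(i,j), b_2(i,j)\in[0,1]$ ($i,j\in\mathbb{Z}_{\ge1}$) be parameters for which there are integers $I,J\ge1$ with $b_k(i+I,j)=b_k(i,j)$ and $b_k(i,j+J)=b_k(i,j)$ for all $i,j\ge 1$ and $k\in\{1,2\}$. The stochastic six vertex (S6V) model with step initial data is the random configuration of lines on the edges of the quadrant $\mathbb{Z}_{\ge1}^2$ in which a line enters every vertex $(1,j)$, $j\ge1$, from the left, no line enters any vertex $(i,1)$, $i\ge1$, from below, and the vertices are sampled sequentially in the order $(1,1),(2,1),(1,2),(3,1),(2,2),(1,3),\dots$, each independently of the past given its input lines: at $(i,j)$, if lines enter from both the left and below, lines leave both to the right and upwards; if none enters, none leaves; if a line enters only from below, it leaves upwards with probability $b_1(i,j)$ and to the right with probability $1-b_1(i,j)$; if a line enters only from the left, it leaves to the right with probability $b_2(i,j)$ and upwards with probability $1-b_2(i,j)$. The complemented S6V model is obtained by erasing every horizontal line that is present and adding a horizontal line on every horizontal edge where there is none, the vertical lines being kept. It is an ensemble of down-right paths, and its height function $H(x,y)$, $(x,y)\in\mathbb{Z}_{\ge0}^2$, is the number of paths passing through or to the left of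 $(x,y)$, that is, the number of $i\in\{1,\dots,x\}$ for which a vertical line leaves $(i,y)$ upwards (so $H(x,0)=H(0,y)=0$). **Theorem 1.4.** There exists a (deterministic) Lipschitz function $g:\mathbb{R}_{\ge0}^2\to\mathbb{R}$ such that, with probability $1$, $$\lim_{n\to\infty}\frac{H(\lfloor nx\rfloor,\lfloor ny\rfloor)}{n}=y-g(x,y)\qquad\text{for all }x,y\in\mathbb{R}_{\ge0}.$$ -/

import Mathlib

open MeasureTheory Filter Topology
open scoped NNReal unitInterval

/-- A configuration of lines on the edges of the quadrant with vertices `(i, j)`, `i, j ≥ 1`.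
`horizontal i j` says that a line occupies the edge from `(i, j)` to `(i + 1, j)`
(`i ≥ 0`, `j ≥ 1`), and `vertical i j` that a line occupies the edge from `(i, j)` to `(i, j + 1)`
(`i ≥ 1`, `j ≥ 0`). The edges with `i = 0`, respectively `j = 0`, are those entering the quadrant
through its left, respectively bottom, boundary. Other values carry no meaning. -/
structure LineEnsemble where
  horizontal : ℕ → ℕ → Bool
  vertical : ℕ → ℕ → Bool

/-- Sampling of one vertex of the stochastic six vertex model. Given whether lines enter from the
west and from the south, and a uniform variable `u ∈ [0, 1]`, returns whether lines leave to the
east and to the north. The six configurations and their probabilities are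
* west and south in, east and north out: `1`;
* nothing in, nothing out: `1`;
* south in, north out: `b₁`;  south in, east out: `1 - b₁`;
* west in, east out: `b₂`;  west in, north out: `1 - b₂`. -/
noncomputable def s6vVertex (b₁ b₂ u : I) (west south : Bool) : Bool × Bool :=
  match west, south with
  | true, true => (true, true)
  | false, false => (false, false)
  | false, true => if u ≤ b₁ then (false, true) else (true, false)
  | true, false => if u ≤ b₂ then (true, false) else (false, true)

/-- The pair (line leaves `(i, j)` to the east, line leaves `(i, j)` to the north) in the stochastic
six vertex model with parameters `b₁ i j`, `b₂ i j` at the vertex `(i, j)`, sampled with the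
variables `u`. Step initial data: a line enters each vertex `(1, j)`, `j ≥ 1`, from the west and
no line enters a vertex `(i, 1)`, `i ≥ 1`, from the south. -/
noncomputable def s6vOut (b₁ b₂ : ℕ → ℕ → I) (u : ℕ × ℕ → I) : ℕ → ℕ → Bool × Bool
  | 0, _ => (true, false)
  | _ + 1, 0 => (false, false)
  | i + 1, j + 1 =>
      s6vVertex (b₁ (i + 1) (j + 1)) (b₂ (i + 1) (j + 1)) (u (i + 1, j + 1))
        (s6vOut b₁ b₂ u i (j + 1)).1 (s6vOut b₁ b₂ u (i + 1) j).2
termination_by i j => (i, j)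

/-- The stochastic six vertex model with step initial data. -/
noncomputable def s6v (b₁ b₂ : ℕ → ℕ → I) (u : ℕ × ℕ → I) : LineEnsemble where
  horizontal i j := (s6vOut b₁ b₂ u i j).1
  vertical i j := (s6vOut b₁ b₂ u i j).2

/-- The probability measure on the sampling variables: they are independent and uniformly
distributed on `[0, 1]`. -/
noncomputable def samplingMeasure : Measure (ℕ × ℕ → I) :=
  Measure.infinitePi fun _ => (volume : Measure I)

/-- Horizontal complementation: horizontal lines are erased where present and added where absent;
vertical lines are kept. -/
def LineEnsemble.complement (L : LineEnsemble) : LineEnsemble where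
  horizontal i j := !L.horizontal i j
  vertical i j := L.vertical i j

/-- The complemented stochastic six vertex (CS6V) model. -/
noncomputable def cs6v (b₁ b₂ : ℕ → ℕ → I) (u : ℕ × ℕ → I) : LineEnsemble :=
  (s6v b₁ b₂ u).complement

/-- The number of lines passing through or to the left of `(x, y)`, for an ensemble of down-right
paths none of which enters through the left boundary. Each such path, followed upwards from the
row `y`, leaves that row at a single vertex `(i, y)` with `1 ≤ i ≤ x`, so the lines are counted
by the vertical edges from `(i, y)` to `(i, y + 1)` that are occupied. -/
def LineEnsemble.heightLeft (L : LineEnsemble) (x y : ℕ) : ℕ :=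
  ((Finset.Icc 1 x).filter fun i => L.vertical i y = true).card

/-- `b` has period `p` in the first and period `q` in the second variable, on the vertices
`(i, j)` with `i, j ≥ 1`. -/
def IsDoublyPeriodic (p q : ℕ) (b : ℕ → ℕ → I) : Prop :=
  ∀ i j : ℕ, 1 ≤ i → 1 ≤ j → b (i + p) j = b i j ∧ b i (j + q) = b i j

/-! ### The six vertex dynamics with general boundary data -/

/-! The height is the flux of vertical lines through the top of a box, `topFlux`, so the claim is a
law of large numbers for this flux. It follows from superadditivity.

Use the same sampling variables for all boundary data. Vertices conserve lines, and the dynamics is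
monotone in its boundary lines. Behind a lattice point (a, c) of the period lattice, the true
configuration has some lines entering from below and some missing on the left. Compared with fresh
step data there, extra lines below can only raise the top flux, while each missing line on the left
lowers it by at most one (`IsSixVertex.topFlux_le`). By conservation the number of missing lines is
exactly the height gained along column a, so the height is superadditive under lattice translations
(`topFlux_add_le`).

Along a lattice ray this gives a bounded superadditive process whose blocks are independent, because
they use disjoint sets of vertices. Its normalised limit is the constant γ = sup E H_m / m
(`ae_tendsto_of_superadditive`): the strong law on blocks gives the lower bound, and a covering
argument bounds the mean of the limsup by γ.

Countably many rays are handled on one almost sure event. The height changes by at most one per unit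
step, so approximating nx, ny by points on these rays gives the limit at all real points at once, as
well as the Lipschitz property of the limit shape. -/

lemma s6vVertex_conserve (b₁ b₂ u : I) (w s : Bool) :
    (s6vVertex b₁ b₂ u w s).1.toNat + (s6vVertex b₁ b₂ u w s).2.toNat = w.toNat + s.toNat := by
  cases w <;> cases s <;> simp only [s6vVertex] <;> (try split_ifs) <;> rfl

/-- Attractivity with a shared u: if two distinct inputs are comparable, the smaller is empty or the
larger is full, and the corresponding output is then empty or full as well. -/
lemma s6vVertex_mono (b₁ b₂ u : I) {w w' s s' : Bool} (hw : w ≤ w') (hs : s ≤ s') :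
    s6vVertex b₁ b₂ u w s ≤ s6vVertex b₁ b₂ u w' s' := by
  revert hw hs
  cases w <;> cases w' <;> cases s <;> cases s' <;> simp only [s6vVertex] <;>
    (try split_ifs) <;> decide

/-- `o` evolves by the stochastic six vertex rule, with arbitrary boundary data. -/
def IsSixVertex (b₁ b₂ : ℕ → ℕ → I) (u : ℕ × ℕ → I) (o : ℕ → ℕ → Bool × Bool) : Prop :=
  ∀ i j, o (i + 1) (j + 1) = s6vVertex (b₁ (i + 1) (j + 1)) (b₂ (i + 1) (j + 1))
    (u (i + 1, j + 1)) (o i (j + 1)).1 (o (i + 1) j).2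

/-- The number of lines leaving through the right side of the box `[1, x] × [1, y]`. -/
def rightFlux (o : ℕ → ℕ → Bool × Bool) (x y : ℕ) : ℕ :=
  ∑ j ∈ Finset.range y, (o x (j + 1)).1.toNat

/-- The number of lines leaving through the top side of the box `[1, x] × [1, y]`. -/
def topFlux (o : ℕ → ℕ → Bool × Bool) (x y : ℕ) : ℕ :=
  ∑ i ∈ Finset.range x, (o (i + 1) y).2.toNat

/-- The configuration with west boundary data `W` and south boundary data `S`. -/
noncomputable def sixVertexBoundary (b₁ b₂ : ℕ → ℕ → I) (u : ℕ × ℕ → I) (W S : ℕ → Bool) :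
    ℕ → ℕ → Bool × Bool
  | 0, j => (W j, false)
  | i + 1, 0 => (false, S (i + 1))
  | i + 1, j + 1 =>
      s6vVertex (b₁ (i + 1) (j + 1)) (b₂ (i + 1) (j + 1)) (u (i + 1, j + 1))
        (sixVertexBoundary b₁ b₂ u W S i (j + 1)).1 (sixVertexBoundary b₁ b₂ u W S (i + 1) j).2
termination_by i j => (i, j)

section

variable {b₁ b₂ : ℕ → ℕ → I} {u : ℕ × ℕ → I} {o o' : ℕ → ℕ → Bool × Bool}

lemma isSixVertex_sixVertexBoundary (W S : ℕ → Bool) :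
    IsSixVertex b₁ b₂ u (sixVertexBoundary b₁ b₂ u W S) := fun i j => by
  rw [sixVertexBoundary]

lemma isSixVertex_s6vOut : IsSixVertex b₁ b₂ u (s6vOut b₁ b₂ u) := fun i j => by
  rw [s6vOut]

lemma s6vOut_zero_left (j : ℕ) : s6vOut b₁ b₂ u 0 j = (true, false) := by
  rw [s6vOut]

lemma s6vOut_zero_right (i : ℕ) : s6vOut b₁ b₂ u (i + 1) 0 = (false, false) := by
  rw [s6vOut]

lemma IsSixVertex.column (h : IsSixVertex b₁ b₂ u o) (x y : ℕ) :
    rightFlux o x y + (o (x + 1) 0).2.toNat =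
      rightFlux o (x + 1) y + (o (x + 1) y).2.toNat := by
  induction y with
  | zero => simp [rightFlux]
  | succ y ih =>
    have h1 := s6vVertex_conserve (b₁ (x + 1) (y + 1)) (b₂ (x + 1) (y + 1)) (u (x + 1, y + 1))
      (o x (y + 1)).1 (o (x + 1) y).2
    rw [← h x y] at h1
    simp only [rightFlux, Finset.sum_range_succ] at ih ⊢
    omega

lemma IsSixVertex.flux (h : IsSixVertex b₁ b₂ u o) (x y : ℕ) :
    rightFlux o 0 y + topFlux o x 0 = rightFlux o x y + topFlux o x y := by
  induction x with
  | zero => simp [topFlux]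
  | succ x ih =>
    have := h.column x y
    simp only [topFlux, Finset.sum_range_succ] at ih ⊢
    omega

lemma IsSixVertex.mono (h : IsSixVertex b₁ b₂ u o) (h' : IsSixVertex b₁ b₂ u o')
    (hW : ∀ j, (o 0 (j + 1)).1 ≤ (o' 0 (j + 1)).1)
    (hS : ∀ i, (o (i + 1) 0).2 ≤ (o' (i + 1) 0).2) (i j : ℕ) :
    (o i (j + 1)).1 ≤ (o' i (j + 1)).1 ∧ (o (i + 1) j).2 ≤ (o' (i + 1) j).2 := by
  have key : ∀ n i j, i + j = n →
      (o i (j + 1)).1 ≤ (o' i (j + 1)).1 ∧ (o (i + 1) j).2 ≤ (o' (i + 1) j).2 := by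
    intro n
    induction n with
    | zero =>
      intro i j hij
      obtain ⟨rfl, rfl⟩ : i = 0 ∧ j = 0 := by omega
      exact ⟨hW 0, hS 0⟩
    | succ n ih =>
      intro i j hij
      constructor
      · cases i with
        | zero => exact hW j
        | succ i =>
          rw [h, h']
          have := ih i j (by omega)
          exact (s6vVertex_mono _ _ _ this.1 this.2).1
      · cases j with
        | zero => exact hS i
        | succ j =>
          rw [h, h']
          have := ih i j (by omega)
          exact (s6vVertex_mono _ _ _ this.1 this.2).2
  exact key _ i j rfl

/-- A configuration without lines entering from below minimises the number of lines leaving through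
the top, up to the number of lines which other boundary data miss on the left. -/
lemma IsSixVertex.topFlux_le (h : IsSixVertex b₁ b₂ u o) (h' : IsSixVertex b₁ b₂ u o')
    (hS : ∀ i, (o (i + 1) 0).2 = false) (x y : ℕ) :
    topFlux o x y + rightFlux o' 0 y ≤ topFlux o' x y + y := by
  -- The configuration m has full left boundary and the bottom boundary of o'. It dominates both o
  -- and o', so its top flux exceeds that of o and its right flux that of o'; conservation turns the
  -- latter into an upper bound for its top flux.
  set m := sixVertexBoundary b₁ b₂ u (fun _ => true) (fun i => (o' i 0).2) with hm
  have hmS : IsSixVertex b₁ b₂ u m := isSixVertex_sixVertexBoundary _ _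
  have m0 : ∀ j, (m 0 j).1 = true := fun j => by rw [hm, sixVertexBoundary]
  have m1 : ∀ i, (m (i + 1) 0).2 = (o' (i + 1) 0).2 := fun i => by rw [hm, sixVertexBoundary]
  have A := h.mono hmS (fun j => by rw [m0]; exact Bool.le_true _)
    (fun i => by rw [hS]; exact Bool.false_le _)
  have B := h'.mono hmS (fun j => by rw [m0]; exact Bool.le_true _)
    (fun i => by rw [m1])
  have e1 : topFlux o x y ≤ topFlux m x y :=
    Finset.sum_le_sum fun i _ => Bool.toNat_le_toNat (A i y).2
  have e2 : rightFlux o' x y ≤ rightFlux m x y :=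
    Finset.sum_le_sum fun j _ => Bool.toNat_le_toNat (B x j).1
  have e3 := hmS.flux x y
  have e4 := h'.flux x y
  have e5 : topFlux m x 0 = topFlux o' x 0 :=
    Finset.sum_congr rfl fun i _ => by rw [m1]
  have e6 : rightFlux m 0 y = y := by simp [rightFlux, m0]
  omega

end

/-! ### The height function -/

/-- Translation of the sampling variables. -/
def shiftSample (a c : ℕ) (u : ℕ × ℕ → I) : ℕ × ℕ → I := fun z => u (z.1 + a, z.2 + c)

lemma shiftSample_shiftSample (a c a' c' : ℕ) (u : ℕ × ℕ → I) :
    shiftSample a c (shiftSample a' c' u) = shiftSample (a + a') (c + c') u := by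
  funext z
  simp [shiftSample, add_assoc]

lemma heightLeft_cs6v (b₁ b₂ : ℕ → ℕ → I) (u : ℕ × ℕ → I) (x y : ℕ) :
    (cs6v b₁ b₂ u).heightLeft x y = topFlux (s6vOut b₁ b₂ u) x y := by
  rw [LineEnsemble.heightLeft, Finset.card_filter, topFlux, Finset.range_eq_Ico,
    Finset.sum_Ico_add' (fun i => (s6vOut b₁ b₂ u i y).2.toNat) 0 x 1]
  refine Finset.sum_congr (by ext; simp) fun i _ => ?_
  cases h : (s6vOut b₁ b₂ u i y).2 <;> simp [cs6v, LineEnsemble.complement, s6v, h]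

lemma IsDoublyPeriodic.add_mul {p q : ℕ} {b : ℕ → ℕ → I} (hb : IsDoublyPeriodic p q b)
    (k l i j : ℕ) : b (i + 1 + p * k) (j + 1 + q * l) = b (i + 1) (j + 1) := by
  have h1 : ∀ k i j, 1 ≤ i → 1 ≤ j → b (i + p * k) j = b i j := by
    intro k
    induction k with
    | zero => simp
    | succ k ih =>
      intro i j hi hj
      rw [mul_add, mul_one, ← add_assoc, (hb _ _ (by omega) hj).1, ih i j hi hj]
  have h2 : ∀ l i j, 1 ≤ i → 1 ≤ j → b i (j + q * l) = b i j := by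
    intro l
    induction l with
    | zero => simp
    | succ l ih =>
      intro i j hi hj
      rw [mul_add, mul_one, ← add_assoc, (hb _ _ hi (by omega)).2, ih i j hi hj]
  rw [h1 _ _ _ (by omega) (by omega), h2 _ _ _ (by omega) (by omega)]

/-! ### Superadditivity, Lipschitz bounds and locality of the height. -/

section

variable {b₁ b₂ : ℕ → ℕ → I} (u : ℕ × ℕ → I)

lemma rightFlux_add_topFlux_s6vOut (x y : ℕ) :
    rightFlux (s6vOut b₁ b₂ u) x y + topFlux (s6vOut b₁ b₂ u) x y = y := by
  rw [← isSixVertex_s6vOut.flux]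
  simp [rightFlux, topFlux, s6vOut_zero_left, s6vOut_zero_right]

lemma topFlux_add_le {p q : ℕ} (hb₁ : IsDoublyPeriodic p q b₁) (hb₂ : IsDoublyPeriodic p q b₂)
    (k l x y : ℕ) :
    topFlux (s6vOut b₁ b₂ u) (p * k) (q * l) +
        topFlux (s6vOut b₁ b₂ (shiftSample (p * k) (q * l) u)) x y ≤
      topFlux (s6vOut b₁ b₂ u) (p * k + x) (q * l + y) := by
  set o := s6vOut b₁ b₂ u with ho
  set a := p * k with ha
  set c := q * l with hc
  -- Since (a, c) is a period, the configuration seen from (a, c) obeys the same rule, driven by the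
  -- shifted variables but with its own boundary lines.
  have ho' : IsSixVertex b₁ b₂ (shiftSample a c u) (fun i j => o (i + a) (j + c)) := fun i j => by
    have := isSixVertex_s6vOut (b₁ := b₁) (b₂ := b₂) (u := u) (i + a) (j + c)
    have e1 : i + 1 + a = i + a + 1 := by omega
    have e2 : j + 1 + c = j + c + 1 := by omega
    have f1 := hb₁.add_mul k l i j
    have f2 := hb₂.add_mul k l i j
    rw [← ha, ← hc, e1, e2] at f1 f2
    simp only [shiftSample, e1, e2, ← f1, ← f2]
    exact this
  have key := (isSixVertex_s6vOut (b₁ := b₁) (b₂ := b₂) (u := shiftSample a c u)).topFlux_le ho'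
    (fun i => by rw [s6vOut_zero_right]) x y
  -- By `c1`, `c2` and `s1`, the number of lines missing on the left of the shifted box is the
  -- growth of the height in column a from row c to row c + y.
  have c1 := rightFlux_add_topFlux_s6vOut (b₁ := b₁) (b₂ := b₂) u a c
  have c2 := rightFlux_add_topFlux_s6vOut (b₁ := b₁) (b₂ := b₂) u a (c + y)
  rw [← ho] at c1 c2
  have s1 : rightFlux o a (c + y) =
      rightFlux o a c + rightFlux (fun i j => o (i + a) (j + c)) 0 y := by
    simp only [rightFlux, Finset.sum_range_add]
    congr 1
    refine Finset.sum_congr rfl fun j _ => ?_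
    rw [zero_add, show c + j + 1 = j + 1 + c by omega]
  have s2 : topFlux o (a + x) (c + y) =
      topFlux o a (c + y) + topFlux (fun i j => o (i + a) (j + c)) x y := by
    simp only [topFlux, Finset.sum_range_add]
    congr 1
    refine Finset.sum_congr rfl fun j _ => ?_
    rw [show a + j + 1 = j + 1 + a by omega, add_comm c]
  omega

/-- Moving right adds vertical edges, one per column. Moving up is controlled by conservation: the
height is y minus the right flux, and one more row adds 0 or 1 to that flux. -/
lemma topFlux_mono {x x' y y' : ℕ} (hx : x ≤ x') (hy : y ≤ y') :
    topFlux (s6vOut b₁ b₂ u) x y ≤ topFlux (s6vOut b₁ b₂ u) x' y' ∧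
      topFlux (s6vOut b₁ b₂ u) x' y' ≤ topFlux (s6vOut b₁ b₂ u) x y + (x' - x) + (y' - y) := by
  obtain ⟨d, rfl⟩ := Nat.exists_eq_add_of_le hx
  obtain ⟨e, rfl⟩ := Nat.exists_eq_add_of_le hy
  have c1 := rightFlux_add_topFlux_s6vOut (b₁ := b₁) (b₂ := b₂) u x y
  have c2 := rightFlux_add_topFlux_s6vOut (b₁ := b₁) (b₂ := b₂) u x (y + e)
  set o := s6vOut b₁ b₂ u
  have s1 : rightFlux o x (y + e) =
      rightFlux o x y + ∑ j ∈ Finset.range e, (o x (y + j + 1)).1.toNat := by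
    simp only [rightFlux, Finset.sum_range_add]
  have s2 : topFlux o (x + d) (y + e) =
      topFlux o x (y + e) + ∑ i ∈ Finset.range d, (o (x + i + 1) (y + e)).2.toNat := by
    simp only [topFlux, Finset.sum_range_add]
  have b1 : ∑ j ∈ Finset.range e, (o x (y + j + 1)).1.toNat ≤ e := by
    simpa using Finset.sum_le_card_nsmul (Finset.range e) _ 1 fun j _ => Bool.toNat_le _
  have b2 : ∑ i ∈ Finset.range d, (o (x + i + 1) (y + e)).2.toNat ≤ d := by
    simpa using Finset.sum_le_card_nsmul (Finset.range d) _ 1 fun j _ => Bool.toNat_le _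
  omega

lemma topFlux_le_left (x y : ℕ) : topFlux (s6vOut b₁ b₂ u) x y ≤ x := by
  simpa [topFlux] using Finset.sum_le_card_nsmul (Finset.range x) _ 1 fun j _ => Bool.toNat_le _

lemma abs_topFlux_sub_le (x y x' y' : ℕ) :
    |(topFlux (s6vOut b₁ b₂ u) x y : ℝ) - topFlux (s6vOut b₁ b₂ u) x' y'| ≤
      |(x : ℝ) - x'| + |(y : ℝ) - y'| := by
  set o := s6vOut b₁ b₂ u with ho
  have key : ∀ x y x' y' : ℕ, (topFlux o x y : ℝ) - topFlux o x' y' ≤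
      |(x : ℝ) - x'| + |(y : ℝ) - y'| := by
    intro x y x' y'
    have h1 := (topFlux_mono (b₁ := b₁) (b₂ := b₂) u (le_max_left x x') (le_max_left y y')).1
    have h2 := (topFlux_mono (b₁ := b₁) (b₂ := b₂) u (le_max_right x x') (le_max_right y y')).2
    rw [← ho] at h1 h2
    have e : ∀ s t : ℕ, ((max s t - t : ℕ) : ℝ) ≤ |(s : ℝ) - t| := by
      intro s t
      rcases le_total s t with h | h
      · simp [h]
      · rw [max_eq_left h, Nat.cast_sub h]
        exact le_abs_self _
    have h3 : (topFlux o x y : ℝ) ≤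
        topFlux o x' y' + (max x x' - x' : ℕ) + (max y y' - y' : ℕ) := by
      exact_mod_cast h1.trans h2
    linarith [e x x', e y y']
  rw [abs_le]
  refine ⟨?_, key x y x' y'⟩
  have := key x' y' x y
  rw [abs_sub_comm (x' : ℝ), abs_sub_comm (y' : ℝ)] at this
  linarith

lemma s6vOut_congr {u v : ℕ × ℕ → I} {x y : ℕ}
    (h : ∀ i j, 1 ≤ i → i ≤ x → 1 ≤ j → j ≤ y → u (i, j) = v (i, j)) :
    s6vOut b₁ b₂ u x y = s6vOut b₁ b₂ v x y := by
  have key : ∀ n i j, i + j = n → i ≤ x → j ≤ y →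
      s6vOut b₁ b₂ u i j = s6vOut b₁ b₂ v i j := by
    intro n
    induction n using Nat.strong_induction_on with
    | _ n ih =>
      intro i j hn hi hj
      match i, j with
      | 0, j => rw [s6vOut_zero_left, s6vOut_zero_left]
      | i + 1, 0 => rw [s6vOut_zero_right, s6vOut_zero_right]
      | i + 1, j + 1 =>
        rw [s6vOut, s6vOut, h _ _ (by omega) hi (by omega) hj,
          ih _ (by omega) i (j + 1) rfl (by omega) hj,
          ih _ (by omega) (i + 1) j rfl hi (by omega)]
  exact key _ x y rfl le_rfl le_rfl

lemma topFlux_congr {u v : ℕ × ℕ → I} {x y : ℕ}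
    (h : ∀ i j, 1 ≤ i → i ≤ x → 1 ≤ j → j ≤ y → u (i, j) = v (i, j)) :
    topFlux (s6vOut b₁ b₂ u) x y = topFlux (s6vOut b₁ b₂ v) x y := by
  refine Finset.sum_congr rfl fun i hi => ?_
  rw [s6vOut_congr fun i' j h1 h2 => h i' j h1 (h2.trans (by simpa using hi))]

end

/-! ### Measurability in the sampling variables. -/

lemma measurable_s6vVertex (b₁ b₂ : I) (w s : Bool) :
    Measurable fun t : I => s6vVertex b₁ b₂ t w s := by
  cases w <;> cases s <;> simp only [s6vVertex]
  · exact measurable_const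
  · exact Measurable.ite measurableSet_Iic measurable_const measurable_const
  · exact Measurable.ite measurableSet_Iic measurable_const measurable_const
  · exact measurable_const

lemma measurable_s6vOut (b₁ b₂ : ℕ → ℕ → I) (x y : ℕ) :
    Measurable fun u => s6vOut b₁ b₂ u x y := by
  have key : ∀ n i j, i + j = n → Measurable fun u => s6vOut b₁ b₂ u i j := by
    intro n
    induction n using Nat.strong_induction_on with
    | _ n ih =>
      intro i j hn
      match i, j with
      | 0, j => simp only [s6vOut_zero_left]; exact measurable_const
      | i + 1, 0 => simp only [s6vOut_zero_right]; exact measurable_const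
      | i + 1, j + 1 =>
        have h1 := (ih _ (by omega) i (j + 1) rfl).fst
        have h2 := (ih _ (by omega) (i + 1) j rfl).snd
        have h3 : Measurable fun z : I × Bool × Bool =>
            s6vVertex (b₁ (i + 1) (j + 1)) (b₂ (i + 1) (j + 1)) z.1 z.2.1 z.2.2 :=
          measurable_from_prod_countable_left fun z => measurable_s6vVertex _ _ z.1 z.2
        have h4 := h3.comp ((measurable_pi_apply (i + 1, j + 1)).prodMk (h1.prodMk h2))
        simp_rw [s6vOut]
        exact h4
  exact key _ x y rfl

lemma measurable_topFlux (b₁ b₂ : ℕ → ℕ → I) (x y : ℕ) :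
    Measurable fun u => topFlux (s6vOut b₁ b₂ u) x y :=
  Finset.measurable_sum _ fun i _ =>
    (measurable_from_top (f := Bool.toNat)).comp (measurable_s6vOut b₁ b₂ (i + 1) y).snd

/-! ### A superadditive ergodic theorem -/

lemma tendsto_natDiv_div {K : ℕ} (hK : 1 ≤ K) {f : ℕ → ℝ} {γ : ℝ}
    (hf : Tendsto (fun n : ℕ => f n / n) atTop (𝓝 γ)) :
    Tendsto (fun n : ℕ => f (n / K) / n) atTop (𝓝 (γ / K)) := by
  have hdiv : Tendsto (fun n : ℕ => n / K) atTop atTop := Nat.tendsto_div_const_atTop (by omega)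
  have hratio : Tendsto (fun n : ℕ => ((n / K : ℕ) : ℝ) / n) atTop (𝓝 (K : ℝ)⁻¹) := by
    have := (tendsto_nat_floor_mul_div_atTop (R := ℝ) (a := (K : ℝ)⁻¹) (by positivity)).comp
      (tendsto_natCast_atTop_atTop (R := ℝ))
    refine this.congr fun n => ?_
    simp only [Function.comp_apply]
    rw [← div_eq_inv_mul, Nat.floor_div_natCast, Nat.floor_natCast]
  rw [div_eq_mul_inv]
  refine ((hf.comp hdiv).mul hratio).congr' ?_
  filter_upwards [eventually_ge_atTop K] with n hn
  have hk : (0 : ℝ) < (n / K : ℕ) := by exact_mod_cast Nat.div_pos hn hK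
  simp only [Function.comp_apply]
  rw [div_mul_div_cancel₀ hk.ne']

section

variable {Ω : Type*} {T : Ω → Ω} {H : ℕ → Ω → ℝ} {C : ℝ}

lemma sum_le_of_superadditive (h0 : ∀ n ω, 0 ≤ H n ω)
    (hsup : ∀ m n ω, H m ω + H n (T^[m] ω) ≤ H (m + n) ω) (m k : ℕ) (ω : Ω) :
    ∑ l ∈ Finset.range k, H m (T^[m * l] ω) ≤ H (m * k) ω := by
  induction k with
  | zero => simpa using h0 _ _
  | succ k ih =>
    rw [Finset.sum_range_succ, mul_add, mul_one]
    linarith [hsup (m * k) m ω]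

/-- Covering the trajectory of `ω` by intervals on which `H` is large. -/
lemma superadditive_covering {B : Set Ω} {c : ℝ} {M : ℕ} (hc : 0 ≤ c) (hM : 1 ≤ M) (hC : c ≤ C)
    (h0 : ∀ n ω, 0 ≤ H n ω) (hsup : ∀ m n ω, H m ω + H n (T^[m] ω) ≤ H (m + n) ω) (N : ℕ) (ω : Ω)
    (hB : ∀ k, T^[k] ω ∉ B → ∃ n, 1 ≤ n ∧ n ≤ M ∧ c * n ≤ H n (T^[k] ω)) :
    c * (N - M) - C * ∑ k ∈ Finset.range N, B.indicator 1 (T^[k] ω) ≤ H N ω := by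
  have hC0 : 0 ≤ C := hc.trans hC
  have hi : ∀ ω, (0 : ℝ) ≤ B.indicator 1 ω :=
    fun ω => Set.indicator_nonneg (fun _ _ => zero_le_one) ω
  induction N using Nat.strong_induction_on generalizing ω with
  | _ N ih =>
    rcases le_or_gt N M with hN | hN
    · have h1 : c * ((N : ℝ) - M) ≤ 0 :=
        mul_nonpos_of_nonneg_of_nonpos hc (sub_nonpos.2 (Nat.cast_le.2 hN))
      have h2 : 0 ≤ C * ∑ k ∈ Finset.range N, B.indicator (1 : Ω → ℝ) (T^[k] ω) :=
        mul_nonneg hC0 (Finset.sum_nonneg fun k _ => hi _)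
      linarith [h0 N ω]
    · have step : ∀ n, 1 ≤ n → n ≤ N →
          c * n ≤ H n ω + C * ∑ k ∈ Finset.range n, B.indicator (1 : Ω → ℝ) (T^[k] ω) →
          c * (N - M) - C * ∑ k ∈ Finset.range N, B.indicator 1 (T^[k] ω) ≤ H N ω := by
        intro n hn hnN hle
        obtain ⟨d, rfl⟩ := Nat.exists_eq_add_of_le hnN
        have h1 := ih d (by omega) (T^[n] ω) fun k hk => by
          rw [← Function.iterate_add_apply] at hk ⊢
          exact hB _ hk
        have h2 := hsup n d ω
        rw [Finset.sum_range_add]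
        simp only [← Function.iterate_add_apply] at h1
        simp only [add_comm _ n] at h1
        push_cast
        linarith
      by_cases hω : ω ∈ B
      -- A bad point is covered by an interval of length 1, at cost c ≤ C, which the indicator term
      -- pays for.
      · refine step 1 le_rfl (by omega) ?_
        simp [hω]
        linarith [h0 1 ω]
      · obtain ⟨n, hn1, hnM, hn⟩ := hB 0 hω
        refine step n hn1 (by omega) ?_
        have h2 : 0 ≤ C * ∑ k ∈ Finset.range n, B.indicator (1 : Ω → ℝ) (T^[k] ω) :=
          mul_nonneg hC0 (Finset.sum_nonneg fun k _ => hi _)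
        simp only [Function.iterate_zero, id_eq] at hn
        linarith

lemma isBoundedUnder_le_div (hC : ∀ n ω, H n ω ≤ C * n) (ω : Ω) (hC0 : 0 ≤ C) :
    IsBoundedUnder (· ≤ ·) atTop fun n : ℕ => H n ω / n :=
  isBoundedUnder_of ⟨C, fun n => div_le_of_le_mul₀ (by positivity) hC0 (hC n ω)⟩

lemma isBoundedUnder_ge_div (h0 : ∀ n ω, 0 ≤ H n ω) (ω : Ω) :
    IsBoundedUnder (· ≥ ·) atTop fun n : ℕ => H n ω / n :=
  isBoundedUnder_of ⟨0, fun n => div_nonneg (h0 n ω) (by positivity)⟩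

/-- Superadditivity with m = 1 gives H_n(Tω) ≤ H_{n+1}(ω), and dividing by n instead of n + 1
changes the quotient by at most C/n. -/
lemma limsup_superadditive_comp_le (hC0 : 0 ≤ C) (h0 : ∀ n ω, 0 ≤ H n ω)
    (hC : ∀ n ω, H n ω ≤ C * n)
    (hsup : ∀ m n ω, H m ω + H n (T^[m] ω) ≤ H (m + n) ω) (ω : Ω) :
    limsup (fun n : ℕ => H n (T ω) / n) atTop ≤ limsup (fun n : ℕ => H n ω / n) atTop := by
  refine le_of_forall_lt fun c hc => ?_
  obtain ⟨d, hcd, hd⟩ := exists_between hc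
  obtain ⟨e, hde, he⟩ := exists_between hd
  have hf : ∃ᶠ n : ℕ in atTop, e < H n (T ω) / n :=
    frequently_lt_of_lt_limsup (isBoundedUnder_ge_div h0 _).isCobounded_flip he
  have ht : Tendsto (fun n : ℕ => C / n) atTop (𝓝 0) :=
    tendsto_const_nhds.div_atTop tendsto_natCast_atTop_atTop
  have hev := (ht.eventually (gt_mem_nhds (sub_pos.2 hde))).and (eventually_ge_atTop 1)
  have hf2 : ∃ᶠ n : ℕ in atTop, d ≤ H (n + 1) ω / ((n + 1 : ℕ) : ℝ) := by
    refine (hf.and_eventually hev).mono fun n hn => ?_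
    obtain ⟨h1, h2, h3⟩ := hn
    have hn0 : (0 : ℝ) < n := by exact_mod_cast h3
    have h4 := hsup 1 n ω
    rw [add_comm 1 n, Function.iterate_one] at h4
    have h5 : H n (T ω) ≤ H (n + 1) ω := by linarith [h0 1 ω]
    have h6 := hC (n + 1) ω
    have h7 : H (n + 1) ω / n - H (n + 1) ω / ((n + 1 : ℕ) : ℝ) ≤ C / n := by
      push_cast at h6 ⊢
      rw [div_sub_div _ _ hn0.ne' (by positivity), div_le_div_iff₀ (by positivity) hn0]
      nlinarith
    have h8 : H n (T ω) / n ≤ H (n + 1) ω / n := by gcongr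
    linarith
  have hf3 : ∃ᶠ n : ℕ in atTop, d ≤ H n ω / n := (tendsto_add_atTop_nat 1).frequently hf2
  exact hcd.trans_le (le_limsup_of_frequently_le hf3 (isBoundedUnder_le_div hC ω hC0))

variable [MeasurableSpace Ω] {μ : Measure Ω}

/-- The two sides have equal integrals, so the inequality cannot be strict on a set of positive
measure. -/
lemma MeasurePreserving.ae_comp_eq_of_comp_le (hT : MeasurePreserving T μ μ) {X : Ω → ℝ}
    (hX : Integrable X μ) (hle : ∀ ω, X (T ω) ≤ X ω) : ∀ᵐ ω ∂μ, X (T ω) = X ω := by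
  have hXT : Integrable (fun ω => X (T ω)) μ := hT.integrable_comp_of_integrable hX
  have h1 : ∫ ω, X (T ω) ∂μ = ∫ ω, X ω ∂μ := by
    have := integral_map (μ := μ) hT.measurable.aemeasurable (f := X)
      (by rw [hT.map_eq]; exact hX.aestronglyMeasurable)
    rw [hT.map_eq] at this
    exact this.symm
  exact (integral_eq_iff_of_ae_le hXT hX (ae_of_all _ hle)).1 h1

lemma MeasurePreserving.integral_comp_of_measurable {S : Ω → Ω} (hS : MeasurePreserving S μ μ)
    {X : Ω → ℝ} (hX : Measurable X) : ∫ ω, X (S ω) ∂μ = ∫ ω, X ω ∂μ := by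
  have := integral_map (μ := μ) hS.measurable.aemeasurable (f := X) hX.aestronglyMeasurable
  rw [hS.map_eq] at this
  exact this.symm

variable [IsProbabilityMeasure μ]

lemma integrable_of_superadditive_bounds (hmeas : ∀ n, Measurable (H n)) (h0 : ∀ n ω, 0 ≤ H n ω)
    (hC : ∀ n ω, H n ω ≤ C * n) (n : ℕ) : Integrable (H n) μ :=
  Integrable.of_bound (hmeas n).aestronglyMeasurable (C * n)
    (ae_of_all _ fun ω => by rw [Real.norm_of_nonneg (h0 n ω)]; exact hC n ω)

/-- The upper bound in the superadditive ergodic theorem. -/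
lemma integral_limsup_superadditive_le (hT : MeasurePreserving T μ μ)
    (hmeas : ∀ n, Measurable (H n)) (hC0 : 0 ≤ C) (h0 : ∀ n ω, 0 ≤ H n ω)
    (hC : ∀ n ω, H n ω ≤ C * n)
    (hsup : ∀ m n ω, H m ω + H n (T^[m] ω) ≤ H (m + n) ω) {γ : ℝ}
    (hγ : ∀ n, 1 ≤ n → ∫ ω, H n ω ∂μ ≤ γ * n) :
    ∫ ω, limsup (fun n : ℕ => H n ω / n) atTop ∂μ ≤ γ := by
  set X : Ω → ℝ := fun ω => limsup (fun n : ℕ => H n ω / n) atTop with hXdef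
  have hXm : Measurable X := Measurable.limsup fun n => (hmeas n).div_const _
  have hX0 : ∀ ω, 0 ≤ X ω := fun ω => le_limsup_of_frequently_le
    (Frequently.of_forall fun n => div_nonneg (h0 n ω) (by positivity))
    (isBoundedUnder_le_div hC ω hC0)
  have hXC : ∀ ω, X ω ≤ C := fun ω => limsup_le_of_le
    (isBoundedUnder_ge_div h0 ω).isCobounded_flip
    (Eventually.of_forall fun n => div_le_of_le_mul₀ (by positivity) hC0 (hC n ω))
  have hXi : Integrable X μ := Integrable.of_bound hXm.aestronglyMeasurable C
    (ae_of_all _ fun ω => by rw [Real.norm_of_nonneg (hX0 ω)]; exact hXC ω)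
  have hinv : ∀ᵐ ω ∂μ, X (T ω) = X ω := MeasurePreserving.ae_comp_eq_of_comp_le hT hXi
    (limsup_superadditive_comp_le hC0 h0 hC hsup)
  have hinv' : ∀ᵐ ω ∂μ, ∀ k, X (T^[k] ω) = X ω := by
    have h1 : ∀ᵐ ω ∂μ, ∀ k, X (T (T^[k] ω)) = X (T^[k] ω) :=
      ae_all_iff.2 fun k => (hT.iterate k).quasiMeasurePreserving.ae hinv
    filter_upwards [h1] with ω hω k
    induction k with
    | zero => rfl
    | succ k ih => rw [Function.iterate_succ_apply', hω, ih]
  refine le_of_forall_pos_le_add fun ε hε => ?_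
  -- Points from which no interval of length at most M has average at least X - ε. Since X is the
  -- limsup, these sets decrease to the empty set.
  let B : ℕ → Set Ω := fun M => {ω | ∀ n, 1 ≤ n → n ≤ M → H n ω < (X ω - ε) * n}
  have hBm : ∀ M, MeasurableSet (B M) := fun M => by
    have : B M = ⋂ n, ⋂ (_ : 1 ≤ n), ⋂ (_ : n ≤ M), {ω | H n ω < (X ω - ε) * n} := by
      ext; simp [B]
    rw [this]
    exact MeasurableSet.iInter fun n => MeasurableSet.iInter fun _ => MeasurableSet.iInter fun _ =>
      measurableSet_lt (hmeas n) ((hXm.sub_const _).mul_const _)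
  have hBt : Tendsto (fun M => μ.real (B M)) atTop (𝓝 0) := by
    have hanti : Antitone B := fun M M' h ω hω n h1 h2 => hω n h1 (h2.trans h)
    have hempty : ⋂ M, B M = ∅ := by
      refine Set.eq_empty_of_forall_notMem fun ω hω => ?_
      have hf : ∃ᶠ n : ℕ in atTop, X ω - ε < H n ω / n :=
        frequently_lt_of_lt_limsup (isBoundedUnder_ge_div h0 _).isCobounded_flip
          (sub_lt_self _ hε)
      obtain ⟨n, hn, hn1⟩ := (hf.and_eventually (eventually_ge_atTop 1)).exists
      have := Set.mem_iInter.1 hω n n hn1 le_rfl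
      rw [lt_div_iff₀ (by exact_mod_cast hn1)] at hn
      linarith
    have := tendsto_measure_iInter_atTop (μ := μ) (fun M => (hBm M).nullMeasurableSet) hanti
      ⟨0, measure_ne_top _ _⟩
    rw [hempty, measure_empty] at this
    exact (ENNReal.tendsto_toReal ENNReal.zero_ne_top).comp this
  have main : ∀ M N : ℕ, 1 ≤ M → M ≤ N → 1 ≤ N →
      (∫ ω, X ω ∂μ - ε) * (N - M) - C * (N * μ.real (B M)) ≤ γ * N := by
    intro M N hM hMN hN
    refine le_trans ?_ (hγ N hN)
    have hsi : ∀ k, Integrable (fun ω => (B M).indicator (1 : Ω → ℝ) (T^[k] ω)) μ := fun k =>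
      (hT.iterate k).integrable_comp_of_integrable
        ((integrable_const (1 : ℝ)).indicator (hBm M))
    have hs : Integrable (fun ω => ∑ k ∈ Finset.range N, (B M).indicator (1 : Ω → ℝ) (T^[k] ω)) μ :=
      integrable_finsetSum _ fun k _ => hsi k
    have hl : Integrable (fun ω => (X ω - ε) * (N - M)) μ :=
      (hXi.sub (integrable_const ε)).mul_const _
    have e : ∫ ω, ((X ω - ε) * (N - M) -
        C * ∑ k ∈ Finset.range N, (B M).indicator (1 : Ω → ℝ) (T^[k] ω)) ∂μ =
        (∫ ω, X ω ∂μ - ε) * (N - M) - C * (N * μ.real (B M)) := by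
      rw [integral_sub hl (hs.const_mul C), integral_mul_const, integral_const_mul,
        integral_sub hXi (integrable_const ε), integral_finsetSum _ fun k _ => hsi k]
      have : ∀ k, ∫ ω, (B M).indicator (1 : Ω → ℝ) (T^[k] ω) ∂μ = μ.real (B M) := fun k => by
        rw [MeasurePreserving.integral_comp_of_measurable (hT.iterate k)
          (measurable_one.indicator (hBm M)), integral_indicator_one (hBm M)]
      simp [this]
    rw [← e]
    refine integral_mono_ae (hl.sub (hs.const_mul C))
      (integrable_of_superadditive_bounds hmeas h0 hC N) ?_
    filter_upwards [hinv'] with ω hω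
    have hnn : 0 ≤ C * ∑ k ∈ Finset.range N, (B M).indicator (1 : Ω → ℝ) (T^[k] ω) :=
      mul_nonneg hC0 (Finset.sum_nonneg fun k _ =>
        Set.indicator_nonneg (fun _ _ => zero_le_one) _)
    -- The covering needs a nonnegative level c = X ω - ε, constant along the orbit by `hω`; for a
    -- negative level the bound is trivial.
    rcases le_or_gt 0 (X ω - ε) with hx | hx
    · refine superadditive_covering hx hM (by linarith [hXC ω]) h0 hsup N ω fun k hk => ?_
      simp only [B, Set.mem_ofPred_eq, not_forall, not_lt, hω k] at hk
      obtain ⟨n, h1, h2, h3⟩ := hk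
      exact ⟨n, h1, h2, h3⟩
    · have : (X ω - ε) * ((N : ℝ) - M) ≤ 0 :=
        mul_nonpos_of_nonpos_of_nonneg hx.le (sub_nonneg.2 (Nat.cast_le.2 hMN))
      linarith [h0 N ω]
  -- Divide by N and let N → ∞ with M fixed; afterwards M → ∞ removes the bad set.
  have lim1 : ∀ M : ℕ, 1 ≤ M → ∫ ω, X ω ∂μ - ε - C * μ.real (B M) ≤ γ := by
    intro M hM
    have ht : Tendsto (fun N : ℕ => (∫ ω, X ω ∂μ - ε) * (1 - M / N) - C * μ.real (B M)) atTop
        (𝓝 ((∫ ω, X ω ∂μ - ε) * (1 - 0) - C * μ.real (B M))) :=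
      ((tendsto_const_nhds.sub
        (tendsto_const_nhds.div_atTop tendsto_natCast_atTop_atTop)).const_mul _).sub_const _
    rw [sub_zero, mul_one] at ht
    refine le_of_tendsto ht ?_
    filter_upwards [eventually_ge_atTop M] with N hN
    have hN0 : (0 : ℝ) < N := by exact_mod_cast hM.trans hN
    have := main M N hM hN (hM.trans hN)
    rw [← mul_le_mul_iff_left₀ hN0]
    refine le_trans (le_of_eq ?_) this
    field_simp
  have lim2 := (hBt.const_mul C).const_sub (∫ ω, X ω ∂μ - ε)
  rw [mul_zero, sub_zero] at lim2
  have := le_of_tendsto lim2 (by filter_upwards [eventually_ge_atTop 1] with M hM using lim1 M hM)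
  linarith

/-- The lower bound in the superadditive ergodic theorem. -/
lemma ae_eventually_lt_of_superadditive (hT : MeasurePreserving T μ μ)
    (hmeas : ∀ n, Measurable (H n)) (h0 : ∀ n ω, 0 ≤ H n ω) (hC : ∀ n ω, H n ω ≤ C * n)
    (hsup : ∀ m n ω, H m ω + H n (T^[m] ω) ≤ H (m + n) ω) {m : ℕ} (hm : 1 ≤ m)
    (hind : Pairwise (Function.onFun (fun f g => ProbabilityTheory.IndepFun f g μ)
      fun l ω => H m (T^[m * l] ω))) :
    ∀ᵐ ω ∂μ, ∀ c, c < (∫ ω, H m ω ∂μ) / m → ∀ᶠ n : ℕ in atTop, c < H n ω / n := by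
  have hTm : ∀ l, MeasurePreserving (T^[m * l]) μ μ := fun l => hT.iterate _
  have hlaw := ProbabilityTheory.strong_law_ae_real (μ := μ) (fun l ω => H m (T^[m * l] ω))
    (by simpa using integrable_of_superadditive_bounds hmeas h0 hC m) hind fun l =>
      ⟨((hmeas m).comp (hTm l).measurable).aemeasurable,
        ((hmeas m).comp (hTm 0).measurable).aemeasurable, by
        have := fun l => Measure.map_map (μ := μ) (hmeas m) (hTm l).measurable
        simp only [(hTm _).map_eq] at this
        exact (this l).symm.trans (this 0)⟩
  filter_upwards [hlaw] with ω hω c hc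
  simp only [mul_zero, Function.iterate_zero, id_eq] at hω
  have hlim := tendsto_natDiv_div hm hω
  filter_upwards [hlim.eventually (lt_mem_nhds hc), eventually_ge_atTop m] with n hn hnm
  have hn0 : (0 : ℝ) < n := by exact_mod_cast hm.trans hnm
  refine hn.trans_le ?_
  gcongr
  -- Keep the ⌊n/m⌋ complete blocks and drop the nonnegative remainder.
  refine (sum_le_of_superadditive h0 hsup m (n / m) ω).trans ?_
  have := hsup (m * (n / m)) (n % m) ω
  rw [Nat.div_add_mod] at this
  linarith [h0 (n % m) (T^[m * (n / m)] ω)]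

/-- **Superadditive ergodic theorem** for a bounded superadditive process with independent
blocks. -/
theorem ae_tendsto_of_superadditive (hT : MeasurePreserving T μ μ)
    (hmeas : ∀ n, Measurable (H n)) (hC0 : 0 ≤ C) (h0 : ∀ n ω, 0 ≤ H n ω)
    (hC : ∀ n ω, H n ω ≤ C * n)
    (hsup : ∀ m n ω, H m ω + H n (T^[m] ω) ≤ H (m + n) ω)
    (hind : ∀ m, 1 ≤ m → Pairwise (Function.onFun (fun f g => ProbabilityTheory.IndepFun f g μ)
      fun l ω => H m (T^[m * l] ω))) :
    ∃ γ : ℝ, ∀ᵐ ω ∂μ, Tendsto (fun n : ℕ => H n ω / n) atTop (𝓝 γ) := by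
  set X : Ω → ℝ := fun ω => limsup (fun n : ℕ => H n ω / n) atTop with hXdef
  have hXm : Measurable X := Measurable.limsup fun n => (hmeas n).div_const _
  have hX0 : ∀ ω, 0 ≤ X ω := fun ω => le_limsup_of_frequently_le
    (Frequently.of_forall fun n => div_nonneg (h0 n ω) (by positivity))
    (isBoundedUnder_le_div hC ω hC0)
  have hXC : ∀ ω, X ω ≤ C := fun ω => limsup_le_of_le
    (isBoundedUnder_ge_div h0 ω).isCobounded_flip
    (Eventually.of_forall fun n => div_le_of_le_mul₀ (by positivity) hC0 (hC n ω))
  have hXi : Integrable X μ := Integrable.of_bound hXm.aestronglyMeasurable C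
    (ae_of_all _ fun ω => by rw [Real.norm_of_nonneg (hX0 ω)]; exact hXC ω)
  set γ : ℝ := ⨆ m : ℕ, (∫ ω, H (m + 1) ω ∂μ) / (m + 1 : ℕ) with hγ
  have hbdd : BddAbove (Set.range fun m : ℕ => (∫ ω, H (m + 1) ω ∂μ) / (m + 1 : ℕ)) := by
    refine ⟨C, ?_⟩
    rintro _ ⟨m, rfl⟩
    refine div_le_of_le_mul₀ (by positivity) hC0 ?_
    simpa using integral_mono (integrable_of_superadditive_bounds (μ := μ) hmeas h0 hC (m + 1))
      (integrable_const (C * ((m + 1 : ℕ) : ℝ))) (hC (m + 1))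
  have hle : ∫ ω, X ω ∂μ ≤ γ := by
    refine integral_limsup_superadditive_le hT hmeas hC0 h0 hC hsup fun n hn => ?_
    obtain ⟨m, rfl⟩ := Nat.exists_eq_add_of_le' hn
    have := le_ciSup hbdd m
    rwa [div_le_iff₀ (by positivity)] at this
  have hlow : ∀ᵐ ω ∂μ, ∀ c, c < γ → ∀ᶠ n : ℕ in atTop, c < H n ω / n := by
    have := ae_all_iff.2 fun m : ℕ => ae_eventually_lt_of_superadditive hT hmeas h0 hC hsup
      (Nat.le_add_left 1 m) (hind (m + 1) (Nat.le_add_left 1 m))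
    filter_upwards [this] with ω hω c hc
    obtain ⟨m, hm⟩ := exists_lt_of_lt_ciSup hc
    exact hω m c hm
  have hge : ∀ᵐ ω ∂μ, γ ≤ X ω := by
    filter_upwards [hlow] with ω hω
    exact le_of_forall_lt_imp_le_of_dense fun c hc => le_limsup_of_frequently_le
      ((hω c hc).mono fun n hn => hn.le).frequently (isBoundedUnder_le_div hC ω hC0)
  -- γ ≤ X almost surely together with E X ≤ γ forces equality.
  have heq : ∀ᵐ ω ∂μ, γ = X ω := by
    refine (integral_eq_iff_of_ae_le (integrable_const γ) hXi hge).1 ?_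
    refine le_antisymm (integral_mono_ae (integrable_const γ) hXi hge) ?_
    simpa using hle
  refine ⟨γ, ?_⟩
  filter_upwards [hlow, heq] with ω h1 h2
  refine tendsto_order.2 ⟨h1, fun c hc => ?_⟩
  exact eventually_lt_of_limsup_lt (h2.symm.trans_lt hc) (isBoundedUnder_le_div hC ω hC0)

end

/-! ### Translation invariance and independence of the sampling variables -/

instance isProbabilityMeasure_samplingMeasure : IsProbabilityMeasure samplingMeasure := by
  unfold samplingMeasure; infer_instance

lemma measurePreserving_shiftSample (a c : ℕ) :
    MeasurePreserving (shiftSample a c) samplingMeasure samplingMeasure where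
  measurable := measurable_pi_lambda _ fun z => measurable_pi_apply _
  map_eq := by
    have hinj : Function.Injective fun z : ℕ × ℕ => (z.1 + a, z.2 + c) := by
      rintro ⟨i, j⟩ ⟨i', j'⟩ h
      simpa using h
    exact Measure.map_infinitePi_infinitePi_of_inj (P := fun _ : ℕ × ℕ => (volume : Measure I))
      hinj

lemma iterate_shiftSample (a c n : ℕ) :
    (shiftSample a c)^[n] = shiftSample (a * n) (c * n) := by
  induction n with
  | zero => rfl
  | succ n ih =>
    funext u
    rw [Function.iterate_succ_apply', ih, shiftSample_shiftSample]
    congr 1 <;> ring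

/-- Extending by 0 off S (`ext S`) writes X as a measurable function of the coordinates in S alone;
coordinates over disjoint finite sets are independent. -/
lemma indepFun_samplingMeasure {X Y : (ℕ × ℕ → I) → ℝ} (hX : Measurable X) (hY : Measurable Y)
    {S T : Finset (ℕ × ℕ)} (hXS : DependsOn X S) (hYT : DependsOn Y T) (hST : Disjoint S T) :
    ProbabilityTheory.IndepFun X Y samplingMeasure := by
  classical
  have hi : ProbabilityTheory.iIndepFun (fun (z : ℕ × ℕ) (u : ℕ × ℕ → I) => u z)
      samplingMeasure := ProbabilityTheory.iIndepFun_infinitePi (X := fun _ => id)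
        fun _ => measurable_id
  let ext : (S : Finset (ℕ × ℕ)) → (S → I) → ℕ × ℕ → I :=
    fun S r z => if h : z ∈ S then r ⟨z, h⟩ else 0
  have hext : ∀ S, Measurable (ext S) := fun S => measurable_pi_lambda _ fun z => by
    by_cases h : z ∈ S
    · simpa only [ext, h, dite_true] using measurable_pi_apply _
    · simpa only [ext, h, dite_false] using measurable_const
  have hfac : ∀ {Z : (ℕ × ℕ → I) → ℝ} {S : Finset (ℕ × ℕ)}, DependsOn Z S →
      (Z ∘ ext S) ∘ (fun u (i : S) => u i) = Z := fun {Z S} hZ => by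
    funext u
    refine hZ fun z hz => ?_
    have hz' : z ∈ S := hz
    simp [ext, hz']
  have := (hi.indepFun_finset S T hST fun z => measurable_pi_apply z).comp
    (hX.comp (hext S)) (hY.comp (hext T))
  rwa [hfac hXS, hfac hYT] at this

/-! ### The law of large numbers along rays and the limit shape -/

lemma ae_tendsto_topFlux_ray {p q : ℕ} {b₁ b₂ : ℕ → ℕ → I} (hp : 1 ≤ p)
    (hb₁ : IsDoublyPeriodic p q b₁) (hb₂ : IsDoublyPeriodic p q b₂) (k l : ℕ) (hk : 1 ≤ k) :
    ∃ γ : ℝ, ∀ᵐ u ∂samplingMeasure, Tendsto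
      (fun n : ℕ => (topFlux (s6vOut b₁ b₂ u) (p * k * n) (q * l * n) : ℝ) / n) atTop (𝓝 γ) := by
  refine ae_tendsto_of_superadditive (T := shiftSample (p * k) (q * l)) (C := (p * k : ℕ))
    (H := fun n u => (topFlux (s6vOut b₁ b₂ u) (p * k * n) (q * l * n) : ℝ))
    (measurePreserving_shiftSample _ _) (fun n => ?_) (Nat.cast_nonneg _)
    (fun n u => Nat.cast_nonneg _) (fun n u => ?_) (fun m n u => ?_) fun m hm => ?_
  · exact (measurable_from_top (f := fun n : ℕ => (n : ℝ))).comp (measurable_topFlux b₁ b₂ _ _)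
  · exact_mod_cast topFlux_le_left u _ _
  · have := topFlux_add_le u hb₁ hb₂ (k * m) (l * m) (p * k * n) (q * l * n)
    rw [iterate_shiftSample]
    rw [← mul_assoc, ← mul_assoc, ← mul_add, ← mul_add] at this
    exact_mod_cast this
  · intro r s hrs
    let S : ℕ → Finset (ℕ × ℕ) := fun r =>
      Finset.Ioc (p * k * m * r) (p * k * m * r + p * k * m) ×ˢ
        Finset.Ioc (q * l * m * r) (q * l * m * r + q * l * m)
    have hmeas : ∀ r, Measurable fun u => (topFlux (s6vOut b₁ b₂
        ((shiftSample (p * k) (q * l))^[m * r] u)) (p * k * m) (q * l * m) : ℝ) := fun r =>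
      (measurable_from_top (f := fun n : ℕ => (n : ℝ))).comp ((measurable_topFlux b₁ b₂ _ _).comp
        ((measurePreserving_shiftSample _ _).iterate _).measurable)
    have hdep : ∀ r, DependsOn (fun u => (topFlux (s6vOut b₁ b₂
        ((shiftSample (p * k) (q * l))^[m * r] u)) (p * k * m) (q * l * m) : ℝ)) (S r) := by
      intro r u v huv
      simp only [iterate_shiftSample]
      congr 1
      refine topFlux_congr fun i j h1 h2 h3 h4 => huv _ ?_
      simp only [S, Finset.coe_product, Finset.coe_Ioc, Set.mem_prod, Set.mem_Ioc]
      simp only [← mul_assoc]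
      omega
    -- Because k ≥ 1, the boxes of different blocks occupy disjoint ranges of columns; their rows
    -- may not matter, as l can be 0.
    have hpk : 0 < p * k * m := by positivity
    have hdisj : ∀ r s, r < s → Disjoint (S r) (S s) := by
      intro r s h
      refine Finset.disjoint_product.2 (Or.inl (Finset.disjoint_left.2 fun z hz hz' => ?_))
      rw [Finset.mem_Ioc] at hz hz'
      have : p * k * m * (r + 1) ≤ p * k * m * s := Nat.mul_le_mul_left _ h
      rw [mul_add, mul_one] at this
      omega
    refine indepFun_samplingMeasure (hmeas r) (hmeas s) (hdep r) (hdep s) ?_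
    rcases lt_or_gt_of_ne hrs with h | h
    · exact hdisj _ _ h
    · exact (hdisj _ _ h).symm

/-- The centres c k do not depend on i, so they form a Cauchy sequence whose limit serves every i.
With i a sampling outcome, this makes the limit deterministic. -/
lemma exists_limit_of_approx {ι : Type*} {a : ι → ℕ → ℝ} {c r : ℕ → ℝ}
    (hr : Tendsto r atTop (𝓝 0)) (i₀ : ι)
    (h : ∀ i k, ∀ᶠ n in atTop, |a i n - c k| ≤ r k) :
    ∃ L, ∀ i, Tendsto (a i) atTop (𝓝 L) := by
  have hdist : ∀ k k', |c k - c k'| ≤ r k + r k' := by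
    intro k k'
    obtain ⟨n, h1, h2⟩ := ((h i₀ k).and (h i₀ k')).exists
    rw [abs_le] at h1 h2 ⊢
    constructor <;> linarith [h1.1, h1.2, h2.1, h2.2]
  have hc : CauchySeq c := by
    refine Metric.cauchySeq_iff.2 fun ε hε => ?_
    obtain ⟨K, hK⟩ := eventually_atTop.1 (hr.eventually (gt_mem_nhds (half_pos hε)))
    refine ⟨K, fun k hk k' hk' => ?_⟩
    rw [Real.dist_eq]
    linarith [hdist k k', hK k hk, hK k' hk']
  obtain ⟨L, hL⟩ := cauchySeq_tendsto_of_complete hc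
  refine ⟨L, fun i => Metric.tendsto_atTop'.2 fun ε hε => ?_⟩
  obtain ⟨k, h1, h2⟩ := ((hr.eventually (gt_mem_nhds (half_pos hε))).and
    (hL.eventually (Metric.ball_mem_nhds L (half_pos hε)))).exists
  obtain ⟨N, hN⟩ := eventually_atTop.1 (h i k)
  refine ⟨N, fun n hn => ?_⟩
  have h3 := hN n hn.le
  have h4 : dist (a i n) (c k) ≤ r k := by rwa [Real.dist_eq]
  linarith [dist_triangle (a i n) (c k) L]

lemma abs_natFloor_mul_sub_le (n : ℕ) (x : ℝ≥0) : |(⌊(n : ℝ≥0) * x⌋₊ : ℝ) - n * x| ≤ 1 := by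
  have h1 : ((⌊(n : ℝ≥0) * x⌋₊ : ℝ≥0) : ℝ) ≤ ((n : ℝ≥0) * x : ℝ≥0) :=
    NNReal.coe_le_coe.2 (Nat.floor_le zero_le)
  have h2 : (((n : ℝ≥0) * x : ℝ≥0) : ℝ) < ((⌊(n : ℝ≥0) * x⌋₊ + 1 : ℝ≥0) : ℝ) :=
    NNReal.coe_lt_coe.2 (Nat.lt_floor_add_one _)
  push_cast at h1 h2
  rw [abs_le]
  constructor <;> linarith

/-- The point `⌊n x⌋` is close to the multiple `p α ⌊n / K⌋` with `α = ⌊x K / p⌋ + 1`. -/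
lemma abs_natFloor_sub_mul_le {p K : ℕ} (hp : 1 ≤ p) (hK : 1 ≤ K) (n : ℕ) (x : ℝ≥0) :
    |(⌊(n : ℝ≥0) * x⌋₊ : ℝ) - (p * (⌊(x : ℝ) * K / p⌋₊ + 1) * (n / K) : ℕ)| ≤
      n * ((p : ℝ) / K) + (1 + p * (⌊(x : ℝ) * K / p⌋₊ + 1)) := by
  have hK0 : (0 : ℝ) < K := by exact_mod_cast hK
  have hp0 : (0 : ℝ) < p := by exact_mod_cast hp
  have h1 := abs_le.1 (abs_natFloor_mul_sub_le n x)
  have h2 := Nat.floor_le (show 0 ≤ (x : ℝ) * K / p by positivity)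
  have h3 := Nat.lt_floor_add_one ((x : ℝ) * K / p)
  push_cast
  set α : ℝ := (⌊(x : ℝ) * K / p⌋₊ : ℝ)
  have hα : 0 ≤ α := Nat.cast_nonneg _
  set m := n / K
  have h4 : (K : ℝ) * m ≤ n := by exact_mod_cast Nat.mul_div_le n K
  have h5 : (n : ℝ) ≤ K * m + K := by
    exact_mod_cast (Nat.lt_mul_div_succ n hK).le
  have h6 : (x : ℝ) ≤ p * (α + 1) / K := by
    rw [div_lt_iff₀ hp0] at h3
    rw [le_div_iff₀ hK0]
    linarith
  have h7 : p * (α + 1) / K ≤ x + p / K := by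
    rw [le_div_iff₀ hp0] at h2
    rw [← sub_le_iff_le_add, ← sub_div, div_le_iff₀ hK0]
    linarith
  have hn : (0 : ℝ) ≤ n := Nat.cast_nonneg n
  have h8 := mul_le_mul_of_nonneg_left h6 hn
  have h9 := mul_le_mul_of_nonneg_left h7 hn
  have e : p * (α + 1) * (m : ℝ) = p * (α + 1) / K * (K * m) := by field_simp
  have hq : 0 ≤ p * (α + 1) / K := by positivity
  have h10 := mul_le_mul_of_nonneg_left h4 hq
  have h11 := mul_le_mul_of_nonneg_left h5 hq
  have e2 : p * (α + 1) / K * (K * m + K) = p * (α + 1) * (m : ℝ) + p * (α + 1) := by field_simp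
  rw [e2] at h11
  rw [← e] at h10
  have h12 : 0 ≤ n * ((p : ℝ) / K) := by positivity
  have h13 : 0 ≤ p * (α + 1) := by positivity
  rw [abs_le]
  constructor <;> linarith

/-- If the limits along all rays through points of `p ℕ × q ℕ` exist, then so do all limits. -/
lemma exists_limit_topFlux {p q : ℕ} (hp : 1 ≤ p) (hq : 1 ≤ q) {b₁ b₂ : ℕ → ℕ → I}
    {γ : ℕ → ℕ → ℝ} {G : Set (ℕ × ℕ → I)} (hG : G.Nonempty)
    (h : ∀ u ∈ G, ∀ k l, Tendsto (fun n : ℕ =>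
      (topFlux (s6vOut b₁ b₂ u) (p * (k + 1) * n) (q * (l + 1) * n) : ℝ) / n) atTop
      (𝓝 (γ k l))) (x y : ℝ≥0) :
    ∃ L : ℝ, ∀ u ∈ G, Tendsto (fun n : ℕ =>
      (topFlux (s6vOut b₁ b₂ u) ⌊(n : ℝ≥0) * x⌋₊ ⌊(n : ℝ≥0) * y⌋₊ : ℝ) / n) atTop (𝓝 L) := by
  obtain ⟨u₀, hu₀⟩ := hG
  suffices key : ∀ (u : G) (k : ℕ), ∀ᶠ n : ℕ in atTop,
      |(topFlux (s6vOut b₁ b₂ u.1) ⌊(n : ℝ≥0) * x⌋₊ ⌊(n : ℝ≥0) * y⌋₊ : ℝ) / n -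
        γ ⌊(x : ℝ) * (k + 1 : ℕ) / p⌋₊ ⌊(y : ℝ) * (k + 1 : ℕ) / q⌋₊ / (k + 1 : ℕ)| ≤
      ((p : ℝ) + q + 1) / (k + 1 : ℕ) by
    obtain ⟨L, hL⟩ := exists_limit_of_approx (tendsto_const_nhds.div_atTop
      (tendsto_natCast_atTop_atTop.comp (tendsto_add_atTop_nat 1))) ⟨u₀, hu₀⟩ key
    exact ⟨L, fun u hu => hL ⟨u, hu⟩⟩
  rintro ⟨u, hu⟩ k
  set K := k + 1
  have hK : 1 ≤ K := Nat.le_add_left 1 k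
  have hK0 : (0 : ℝ) < K := by exact_mod_cast hK
  set α := ⌊(x : ℝ) * K / p⌋₊ with hα
  set β := ⌊(y : ℝ) * K / q⌋₊ with hβ
  set o := s6vOut b₁ b₂ u with ho
  have hlim := tendsto_natDiv_div hK
    (f := fun n => (topFlux o (p * (α + 1) * n) (q * (β + 1) * n) : ℝ)) (h u hu α β)
  have herr : Tendsto (fun n : ℕ => (p : ℝ) / K + q / K +
      ((1 + p * (α + 1) + (1 + q * (β + 1)) : ℝ)) / n +
      |(topFlux o (p * (α + 1) * (n / K)) (q * (β + 1) * (n / K)) : ℝ) / n - γ α β / K|) atTop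
      (𝓝 ((p : ℝ) / K + q / K + 0 + |γ α β / K - γ α β / K|)) :=
    (tendsto_const_nhds.add (tendsto_const_nhds.div_atTop tendsto_natCast_atTop_atTop)).add
      (hlim.sub_const _).abs
  -- The extra 1 in the numerator leaves room for the error terms that vanish as n → ∞.
  have hlt : (p : ℝ) / K + q / K + 0 + |γ α β / K - γ α β / K| < ((p : ℝ) + q + 1) / K := by
    rw [sub_self, abs_zero, add_zero, add_zero, ← add_div]
    exact div_lt_div_of_pos_right (lt_add_one _) hK0
  filter_upwards [herr.eventually (gt_mem_nhds hlt), eventually_ge_atTop 1] with n hn hn1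
  have hn0 : (0 : ℝ) < n := by exact_mod_cast hn1
  refine le_trans ?_ hn.le
  have h1 := abs_topFlux_sub_le (b₁ := b₁) (b₂ := b₂) u ⌊(n : ℝ≥0) * x⌋₊ ⌊(n : ℝ≥0) * y⌋₊
    (p * (α + 1) * (n / K)) (q * (β + 1) * (n / K))
  have h2 := abs_natFloor_sub_mul_le hp hK n x
  have h3 := abs_natFloor_sub_mul_le hq hK n y
  rw [← ho] at h1
  rw [← hα] at h2
  rw [← hβ] at h3
  refine (abs_sub_le _ ((topFlux o (p * (α + 1) * (n / K)) (q * (β + 1) * (n / K)) : ℝ) / n)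
    _).trans (add_le_add ?_ le_rfl)
  rw [← sub_div, abs_div, abs_of_pos hn0, div_le_iff₀ hn0, add_mul, div_mul_cancel₀ _ hn0.ne']
  linarith

theorem theorem1p4 (p q : ℕ) (hp : 1 ≤ p) (hq : 1 ≤ q)
    (b₁ b₂ : ℕ → ℕ → unitInterval)
    (hb₁ : IsDoublyPeriodic p q b₁) (hb₂ : IsDoublyPeriodic p q b₂) :
    ∃ g : ℝ≥0 × ℝ≥0 → ℝ, (∃ K : ℝ≥0, LipschitzWith K g) ∧
      ∀ᵐ u ∂samplingMeasure, ∀ x y : ℝ≥0,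
        Tendsto
          (fun n : ℕ => ((cs6v b₁ b₂ u).heightLeft ⌊(n : ℝ≥0) * x⌋₊ ⌊(n : ℝ≥0) * y⌋₊ : ℝ) / (n : ℝ))
          atTop (𝓝 ((y : ℝ) - g (x, y))) := by
  choose γ hγ using fun k l : ℕ =>
    ae_tendsto_topFlux_ray hp hb₁ hb₂ (k + 1) (l + 1) (Nat.le_add_left 1 k)
  have hall := ae_all_iff.2 fun k => ae_all_iff.2 fun l => hγ k l
  obtain ⟨u₀, hu₀⟩ := hall.exists
  choose L hL using exists_limit_topFlux hp hq (b₁ := b₁) (b₂ := b₂) (γ := γ)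
    (G := {u | ∀ k l, Tendsto (fun n : ℕ =>
      (topFlux (s6vOut b₁ b₂ u) (p * (k + 1) * n) (q * (l + 1) * n) : ℝ) / n) atTop
      (𝓝 (γ k l))}) ⟨u₀, hu₀⟩ fun u hu => hu
  -- The constant 3 in the sup metric: each coordinate contributes once through L, and the second
  -- once more through y.
  refine ⟨fun z => z.2 - L z.1 z.2, ⟨3, LipschitzWith.of_dist_le_mul fun z w => ?_⟩, ?_⟩
  -- The 4 collects four floor errors of at most 1, two in each coordinate.
  · have hinv : Tendsto (fun n : ℕ => (4 : ℝ) / n) atTop (𝓝 0) :=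
      tendsto_const_nhds.div_atTop tendsto_natCast_atTop_atTop
    have hle : |L z.1 z.2 - L w.1 w.2| ≤ |(z.1 : ℝ) - w.1| + |(z.2 : ℝ) - w.2| + 0 := by
      refine le_of_tendsto_of_tendsto ((hL z.1 z.2 u₀ hu₀).sub (hL w.1 w.2 u₀ hu₀)).abs
        (hinv.const_add _) ?_
      filter_upwards [eventually_ge_atTop 1] with n hn
      have hn0 : (0 : ℝ) < n := by exact_mod_cast hn
      rw [← sub_div, abs_div, abs_of_pos hn0, div_le_iff₀ hn0, add_mul, div_mul_cancel₀ _ hn0.ne']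
      refine (abs_topFlux_sub_le u₀ _ _ _ _).trans ?_
      have key : ∀ x x' : ℝ≥0, |(⌊(n : ℝ≥0) * x⌋₊ : ℝ) - ⌊(n : ℝ≥0) * x'⌋₊| ≤
          |(x : ℝ) - x'| * n + 2 := by
        intro x x'
        have h1 := abs_le.1 (abs_natFloor_mul_sub_le n x)
        have h2 := abs_le.1 (abs_natFloor_mul_sub_le n x')
        have h3 := abs_le.1 (le_of_eq (abs_mul ((x : ℝ) - x') n))
        rw [abs_of_pos hn0] at h3
        rw [abs_le]
        constructor <;> linarith
      linarith [key z.1 w.1, key z.2 w.2]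
    have d1 : |(z.1 : ℝ) - w.1| ≤ dist z w := le_max_left _ _
    have d2 : |(z.2 : ℝ) - w.2| ≤ dist z w := le_max_right _ _
    rw [Real.dist_eq]
    have h := abs_sub ((z.2 : ℝ) - w.2) (L z.1 z.2 - L w.1 w.2)
    rw [show (z.2 : ℝ) - w.2 - (L z.1 z.2 - L w.1 w.2) =
      z.2 - L z.1 z.2 - (w.2 - L w.1 w.2) by ring] at h
    refine h.trans ?_
    push_cast
    linarith
  · filter_upwards [hall] with u hu x y
    simp only [heightLeft_cs6v, sub_sub_cancel]
    exact hL x y u hu
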